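/- Let $\mathbf{k}$ be a field of characteristic zero and $\Omega$ a nonempty set. Let $X=(X(n))_{n\ge 1}$ be a family of sets. $\mathscr{T}(M)(n)$ denotes the vector space spanned by the planar rooted trees with $n$ leaves labelled bijectively by $1,\dots,n$, each internal vertex with $j$ inputs being decorated by an element of $X(j)$. With relabelling of leaves as right symmetric group action ($(t\cdot\sigma)$ carries the label $\sigma^{-1}(i)$ where $t$ carries $i$) and grafting as composition this is the free operad on the $\mathbb{S}$-module $M$ with $\mathbb{S}$-basis $X$. Let $R\subseteq \mathscr{T}(M)$ be a set of relations such that the presented operad $\mathscr{P}=\mathscr{T}(M)/\langle R\rangle$ is locally homogeneous, i.e. $\langle R\rangle$ is generated, as an operadic ideal, by the homogeneous elements of $R$ (those whose trees all have the same number $m$ of internal vertices, called the weight; every $m\ge 0$ is allowed, so generators with symmetries are covered through relations of weight one). Let $X_\Omega=X\times\Omega$, with elements written $x_\omega$, and let $M_\Omega=\bigoplus_{\omega\in\Omega}M_\omega$ be the $\mathbb{S}$-module with $\mathbb{S}$-basis $X_\Omega$. For a map $c:\Omega\to\mathbb{Z}_{\ge0}$ with $\sum_\omega c_\omega=m$ and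 an $X$-decorated tree $t$ of weight $m$, a lift of $t$ of type $c$ is an $X_\Omega$-decorated tree obtained from $t$ by replacing each decoration $x$ by some $x_\omega$ so that each $\omega$ is used exactly $c_\omega$ times. Let $r=\sum_i\alpha_i t_i\in R$ be homogeneous of weight $m$ (distinct trees $t_i$, all $\alpha_i\neq 0$). * The quasipolarization $r_c$ is $\sum_i \alpha_i\sum_{D}D$, where $D$ runs over the lifts of $t_i$ of type $c$. The linearly compatible operad $\mathrm{Lin}(\mathscr{P})_\Omega$ is $\mathscr{T}(M_\Omega)$ modulo the operadic ideal generated by all $r_c$. * A foliation of $r_c$ is given by listing, for each $i$, the lifts of $t_i$ of type $c$ without repetition as $D_{i,1},\dots,D_{i,s}$; its parts are the sums $\sum_i\alpha_iD_{i,j}$, $1\le j\le s$. A matching compatibility of $R$ is a choice of a foliation for every homogeneous $r\in R$ and every $c$, such that the set of all parts for $r\cdot\rho$ is obtained by applying $\rho$ to the set of all parts for $r$. It is leveled if in every part $\sum_i\alpha_iD_{i,j}$, for every $\ell$ with $1\le \ell\le m$, the $\ell$-th vertices (in depth-first preorder) of the trees $D_{i,j}$ have the same $\Omega$-color for all $i$.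 The leveled matching operad $\mathrm{LMT}(\mathscr{P})_\Omega$ is $\mathscr{T}(M_\Omega)$ modulo the operadic ideal generated by all parts of the leveled matching compatibility. Both constructions yield operads with a presentation of the same kind, so they can be iterated (with respect to these presentations). Then $$\mathrm{LMT}\big(\mathrm{Lin}(\mathscr{P})_\Omega\big)_\Omega=\mathrm{Lin}\big(\mathrm{LMT}(\mathscr{P})_\Omega\big)_\Omega\qquad\text{and}\qquad \mathrm{LMT}\big(\mathrm{LMT}(\mathscr{P})_\Omega\big)_\Omega=\mathrm{LMT}(\mathscr{P})_{\Omega^2},$$ where the equalities mean: there is an isomorphism of operads from the left-hand side to the right-hand side that identifies the generators as follows. In the first equality, for all $x\in X(n)$ and $\mu,\nu\in\Omega$, the generator $(x_\mu)_\nu$ of the left-hand side (linear parameter $\mu$, matching parameter $\nu$) goes to the generator $(x_\nu)_\mu$ of the right-hand side (matching parameter $\nu$, linear parameter $\mu$). In the second equality, $(x_\mu)_\nu$ goes to $x_{(\mu,\nu)}$. -/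

import Mathlib

universe u v w z

namespace OperadCompat

/-! ### Decorated planar rooted trees -/

/-- Planar rooted trees whose leaves carry labels in `A` and whose internal vertices with `n`
inputs carry a decoration in `X n`. The tree `leaf a` has no internal vertex. -/
inductive DTree (X : ℕ → Type u) (A : Type v) : Type (max u v)
  | leaf (a : A) : DTree X A
  | node {n : ℕ} (x : X n) (child : Fin n → DTree X A) : DTree X A

namespace DTree

variable {X : ℕ → Type u} {A : Type v} {B : Type w} {Ω : Type z}

/-- The leaf labels, from left to right. -/
def leaves : DTree X A → List A
  | leaf a => [a]
  | node _ child => (List.ofFn fun i => (child i).leaves).flatten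

/-- The number of internal vertices. -/
def weight : DTree X A → ℕ
  | leaf _ => 0
  | node _ child => 1 + (List.ofFn fun i => (child i).weight).sum

/-- Replace the leaf labelled `a` by the tree `s a`. -/
def subst (s : A → DTree X B) : DTree X A → DTree X B
  | leaf a => s a
  | node x child => node x fun i => (child i).subst s

/-- Change the labels of the leaves along `e`. -/
def mapLeaf (e : A → B) (t : DTree X A) : DTree X B := t.subst fun a => leaf (e a)

/-- Forget the second component `ω` of each decoration `(x, ω)`, that is, compose the decoration
with the projection `X × Ω → X`. -/
def forget : DTree (fun n => X n × Ω) A → DTree X A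
  | leaf a => leaf a
  | node x child => node x.1 fun i => (child i).forget

/-- The components in `Ω` of the decorations, listed in the (depth-first) preorder: first the root
vertex, then the subtrees from left to right. -/
def colors : DTree (fun n => X n × Ω) A → List Ω
  | leaf _ => []
  | node x child => x.2 :: (List.ofFn fun i => (child i).colors).flatten

theorem leaves_subst (s : A → DTree X B) (t : DTree X A) :
    (t.subst s).leaves = t.leaves.flatMap fun a => (s a).leaves := by
  induction t with
  | leaf a => simp [subst, leaves]
  | node x child ih =>
    simp only [subst, leaves, ih]
    simp only [List.flatMap_def, List.map_flatten, List.map_ofFn, Function.comp_def,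
      List.flatten_flatten]

theorem leaves_mapLeaf (e : A → B) (t : DTree X A) :
    (t.mapLeaf e).leaves = t.leaves.map e := by
  rw [mapLeaf, leaves_subst]
  simp [leaves, List.flatMap_def]
  induction t.leaves with
  | nil => rfl
  | cons a l ih => simp [ih]

theorem leaves_forget (t : DTree (fun n => X n × Ω) A) : t.forget.leaves = t.leaves := by
  induction t with
  | leaf a => rfl
  | node x child ih => simp only [forget, leaves, ih]

theorem length_colors (t : DTree (fun n => X n × Ω) A) :
    t.colors.length = t.forget.weight := by
  induction t with
  | leaf a => rfl
  | node x child ih =>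
    simp only [forget, colors, weight, List.length_cons, List.length_flatten, List.map_ofFn,
      Function.comp_def, ih]
    omega

end DTree

/-- Decorated planar rooted trees with `n` leaves, labelled bijectively by `Fin n`. -/
def LTree (X : ℕ → Type u) (n : ℕ) : Type u :=
  {t : DTree X (Fin n) // t.leaves.Perm (List.finRange n)}

namespace LTree

variable {X : ℕ → Type u} {Ω : Type z} {n : ℕ}

/-- The leaf labelled `i` gets the label `σ i`. -/
def relabel (σ : Equiv.Perm (Fin n)) (t : LTree X n) : LTree X n :=
  ⟨t.1.mapLeaf σ, by
    rw [DTree.leaves_mapLeaf]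
    exact (t.2.map σ).trans (Equiv.Perm.map_finRange_perm σ)⟩

/-- The tree without internal vertices. -/
def trivial (X : ℕ → Type u) : LTree X 1 := ⟨DTree.leaf 0, by simp [DTree.leaves, List.finRange_succ]⟩

/-- The tree with one internal vertex, decorated by `x`, and leaves labelled from left to right. -/
def corolla (x : X n) : LTree X n :=
  ⟨DTree.node x fun i => DTree.leaf i, by
    simp only [DTree.leaves]
    have h : (List.ofFn fun i : Fin n => [i]).flatten = List.finRange n := by
      rw [List.ofFn_eq_map, ← List.flatMap_def]
      induction List.finRange n with
      | nil => rfl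
      | cons a l ih => simp
    rw [h]⟩

/-- Grafting: the root of `s i` is attached to the leaf of `t` labelled `i`; the leaf of `s i`
labelled `j` gets the label `n 0 + ⋯ + n (i - 1) + j`. -/
def graft {m : ℕ} {n : Fin m → ℕ} (t : LTree X m) (s : ∀ i, LTree X (n i)) :
    LTree X (∑ i, n i) :=
  ⟨t.1.subst fun i => (s i).1.mapLeaf fun j => finSigmaFinEquiv ⟨i, j⟩, by
    rw [DTree.leaves_subst]
    simp only [DTree.leaves_mapLeaf]
    have hs : ∀ i, ((s i).1.leaves.map fun j => finSigmaFinEquiv (⟨i, j⟩ : Sigma _)).Perm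
        ((List.finRange (n i)).map fun j => finSigmaFinEquiv (⟨i, j⟩ : Sigma _)) :=
      fun i => (s i).2.map _
    refine (List.Perm.flatMap t.2 fun i _ => hs i).trans ?_
    rw [List.perm_ext_iff_of_nodup _ (List.nodup_finRange _)]
    · intro a
      simp only [List.mem_flatMap, List.mem_finRange, true_and, List.mem_map, iff_true]
      exact ⟨(finSigmaFinEquiv.symm a).1, (finSigmaFinEquiv.symm a).2, by simp⟩
    · rw [List.nodup_flatMap]
      refine ⟨fun i _ => (List.nodup_finRange _).map fun j j' h => ?_, ?_⟩
      · simpa using h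
      · refine (List.nodup_finRange m).imp ?_
        intro i i' hne a ha ha'
        simp only [List.mem_map, List.mem_finRange, true_and] at ha ha'
        obtain ⟨j, rfl⟩ := ha
        obtain ⟨j', h⟩ := ha'
        have := finSigmaFinEquiv.injective h
        exact hne (congrArg Sigma.fst this).symm⟩

/-- The number of internal vertices. -/
def weight (t : LTree X n) : ℕ := t.1.weight

/-- The projection of decorations from `X × Ω` to `X`. -/
def forget (D : LTree (fun n => X n × Ω) n) : LTree X n :=
  ⟨D.1.forget, by rw [DTree.leaves_forget]; exact D.2⟩

/-- The colors in `Ω` of the vertices, in preorder. -/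
def colors (D : LTree (fun n => X n × Ω) n) : List Ω := D.1.colors

open Classical in
/-- The type of a colored tree: the map sending `ω` to the number of vertices colored `ω`. -/
noncomputable def type (D : LTree (fun n => X n × Ω) n) : Ω →₀ ℕ :=
  Multiset.toFinsupp (D.colors : Multiset Ω)

/-- The lifts of type `c` of a decorated tree: all colorings of its vertices by elements of `Ω`
in which, for each `ω`, exactly `c ω` vertices have the color `ω`. -/
def Lifts (t : LTree X n) (c : Ω →₀ ℕ) : Set (LTree (fun n => X n × Ω) n) :=
  {D | D.forget = t ∧ D.type = c}

end LTree

/-! ### The free operad -/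

section Free

variable (k : Type w) [Field k] (X : ℕ → Type u)

/-- Arity `n` of the free operad on the generating operations `X`: linear combinations of
decorated trees with leaves labelled by `Fin n`. -/
abbrev Free (n : ℕ) : Type (max u w) := LTree X n →₀ k

variable {k X}

/-- The right action of the symmetric group: the leaf labelled `i` gets the label `σ⁻¹ i`. -/
noncomputable def Free.act {n : ℕ} (σ : Equiv.Perm (Fin n)) : Free k X n →ₗ[k] Free k X n :=
  Finsupp.lmapDomain k k (LTree.relabel σ⁻¹)

/-- The identity of the free operad. -/
noncomputable def Free.one : Free k X 1 := Finsupp.single (LTree.trivial X) 1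

/-- The generating operation `x`, as an element of the free operad. -/
noncomputable def Free.of {n : ℕ} (x : X n) : Free k X n := Finsupp.single (LTree.corolla x) 1

open Classical in
/-- The composition maps `γ(f; g_1, …, g_m)` of the free operad: the multilinear extension of the
grafting of trees. -/
noncomputable def Free.comp {m : ℕ} (n : Fin m → ℕ) :
    Free k X m →ₗ[k] MultilinearMap k (fun i => Free k X (n i)) (Free k X (∑ i, n i)) :=
  Finsupp.linearCombination k fun t : LTree X m =>
    ((Finsupp.lmapDomain k k fun s : ∀ i, LTree X (n i) => t.graft s) ∘ₗ
      (PiTensorProduct.ofFinsuppEquiv' (R := k)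
        (κ := fun i => LTree X (n i))).toLinearMap).compMultilinearMap (PiTensorProduct.tprod k)

theorem Free.comp_single {m : ℕ} (n : Fin m → ℕ) (t : LTree X m) (s : ∀ i, LTree X (n i)) :
    Free.comp n (Finsupp.single t (1 : k)) (fun i => Finsupp.single (s i) 1) =
      Finsupp.single (t.graft s) 1 := by
  classical
  simp [Free.comp, PiTensorProduct.ofFinsuppEquiv'_tprod_single]

/-- `f` is homogeneous of weight `m`: a linear combination of trees with `m` vertices. -/
def Free.IsHomogeneous {n : ℕ} (f : Free k X n) (m : ℕ) : Prop :=
  ∀ t ∈ f.support, t.weight = m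

variable (k X) in
/-- Operadic ideals of the free operad. -/
structure OperadicIdeal where
  carrier : ∀ n, Submodule k (Free k X n)
  act_mem : ∀ {n : ℕ} (σ : Equiv.Perm (Fin n)) (f : Free k X n),
    f ∈ carrier n → f.act σ ∈ carrier n
  comp_mem_left : ∀ {m : ℕ} (n : Fin m → ℕ) (f : Free k X m) (g : ∀ i, Free k X (n i)),
    f ∈ carrier m → Free.comp n f g ∈ carrier (∑ i, n i)
  comp_mem_right : ∀ {m : ℕ} (n : Fin m → ℕ) (f : Free k X m) (g : ∀ i, Free k X (n i))
    (i : Fin m), g i ∈ carrier (n i) → Free.comp n f g ∈ carrier (∑ i, n i)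

/-- The operadic ideal `⟨R⟩` generated by `R`: the intersection of all operadic ideals that
contain `R`. -/
noncomputable def OperadicIdeal.span (R : ∀ n, Set (Free k X n)) : OperadicIdeal k X where
  carrier n := ⨅ (I : OperadicIdeal k X) (_ : ∀ j, R j ⊆ I.carrier j), I.carrier n
  act_mem σ f hf := by
    simp only [Submodule.mem_iInf] at hf ⊢
    exact fun I hI => I.act_mem σ f (hf I hI)
  comp_mem_left n f g hf := by
    simp only [Submodule.mem_iInf] at hf ⊢
    exact fun I hI => I.comp_mem_left n f g (hf I hI)
  comp_mem_right n f g i hg := by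
    simp only [Submodule.mem_iInf] at hg ⊢
    exact fun I hI => I.comp_mem_right n f g i (hg I hI)

end Free

/-! ### Operads presented by generators and relations -/

/-- A presentation `𝒯(M)/⟨R⟩` of a reduced operad by generating operations and relations. The
`𝕊`-module `M` has the `𝕊`-basis `gen`. The relations may have any weight; in particular, the
symmetries of the generating operations of a non-free `𝕊`-module are relations of weight one. -/
structure OperadPresentation (k : Type w) [Field k] where
  gen : ℕ → Type u
  reduced : IsEmpty (gen 0)
  rel : ∀ n, Set (Free k gen n)

namespace OperadPresentation

variable {k : Type w} [Field k] (P : OperadPresentation.{u} k)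

/-- The operadic ideal `⟨R⟩`. -/
noncomputable def ideal : OperadicIdeal k P.gen := OperadicIdeal.span P.rel

/-- The homogeneous relations. -/
def homRel (n : ℕ) : Set (Free k P.gen n) := {r | r ∈ P.rel n ∧ ∃ m, r.IsHomogeneous m}

/-- The operadic ideal of relations is generated by homogeneous relations. -/
def LocallyHomogeneous : Prop :=
  ∀ n, P.ideal.carrier n = (OperadicIdeal.span P.homRel).carrier n

/-- Arity `n` of the operad `𝒯(M)/⟨R⟩`. -/
abbrev Op (n : ℕ) : Type (max u w) := Free k P.gen n ⧸ P.ideal.carrier n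

/-- The quotient map `𝒯(M) → 𝒯(M)/⟨R⟩`. -/
noncomputable def proj {n : ℕ} : Free k P.gen n →ₗ[k] P.Op n := (P.ideal.carrier n).mkQ

/-- The class of a generating operation. -/
noncomputable def of {n : ℕ} (x : P.gen n) : P.Op n := P.proj (Free.of x)

/-- The right action of the symmetric group on `𝒯(M)/⟨R⟩`. -/
noncomputable def act {n : ℕ} (σ : Equiv.Perm (Fin n)) : P.Op n →ₗ[k] P.Op n :=
  (P.ideal.carrier n).mapQ (P.ideal.carrier n) (Free.act σ)
    fun f hf => P.ideal.act_mem σ f hf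

/-- The identity of `𝒯(M)/⟨R⟩`. -/
noncomputable def one : P.Op 1 := P.proj Free.one

/-- The composition maps of `𝒯(M)/⟨R⟩`, computed on representatives; the result does not depend on
the representatives by `comp_proj`. -/
noncomputable def comp {m : ℕ} (n : Fin m → ℕ) (f : P.Op m) (g : ∀ i, P.Op (n i)) :
    P.Op (∑ i, n i) :=
  P.proj (Free.comp n (Quotient.out f) fun i => Quotient.out (g i))

theorem proj_out {n : ℕ} (f : P.Op n) : P.proj (Quotient.out f) = f := Quotient.out_eq f

theorem proj_eq_proj_iff {n : ℕ} (f g : Free k P.gen n) :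
    P.proj f = P.proj g ↔ f - g ∈ P.ideal.carrier n :=
  Submodule.Quotient.eq _

theorem proj_comp_congr_right {m : ℕ} (n : Fin m → ℕ) (f : Free k P.gen m)
    (g g' : ∀ i, Free k P.gen (n i)) (h : ∀ i, P.proj (g i) = P.proj (g' i)) :
    P.proj (Free.comp n f g) = P.proj (Free.comp n f g') := by
  classical
  have key : ∀ s : Finset (Fin m),
      P.proj (Free.comp n f (s.piecewise g g')) = P.proj (Free.comp n f g') := by
    intro s
    induction s using Finset.induction_on with
    | empty => simp
    | insert i s hi ih =>
      rw [← ih, Finset.piecewise_insert, proj_eq_proj_iff]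
      have h1 : s.piecewise g g' = Function.update (s.piecewise g g') i (g' i) := by
        rw [eq_comm, Function.update_eq_self_iff]
        simp [hi]
      have h2 : Free.comp n f (Function.update (s.piecewise g g') i (g i)) -
          Free.comp n f (s.piecewise g g') =
          Free.comp n f (Function.update (s.piecewise g g') i (g i - g' i)) := by
        rw [MultilinearMap.map_update_sub, ← h1]
      rw [h2]
      refine P.ideal.comp_mem_right n f _ i ?_
      rw [Function.update_self]
      exact (P.proj_eq_proj_iff _ _).1 (h i)
  simpa using key Finset.univ

theorem comp_proj {m : ℕ} (n : Fin m → ℕ) (f : Free k P.gen m) (g : ∀ i, Free k P.gen (n i)) :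
    P.comp n (P.proj f) (fun i => P.proj (g i)) = P.proj (Free.comp n f g) := by
  unfold comp
  rw [P.proj_comp_congr_right n _ _ g fun i => P.proj_out _, proj_eq_proj_iff]
  have : Free.comp n (Quotient.out (P.proj f)) g - Free.comp n f g =
      Free.comp n (Quotient.out (P.proj f) - f) g := by
    rw [map_sub, sub_apply]
  rw [this]
  exact P.ideal.comp_mem_left n _ g ((P.proj_eq_proj_iff _ _).1 (P.proj_out _))

/-- Isomorphisms between operads `𝒯(M)/⟨R⟩` and `𝒯(N)/⟨S⟩`: linear bijections in each arity that
preserve the symmetric group actions, the identities and the composition maps. -/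
structure Iso (P : OperadPresentation.{u} k) (Q : OperadPresentation.{v} k) where
  equiv : ∀ n, P.Op n ≃ₗ[k] Q.Op n
  map_act : ∀ {n : ℕ} (σ : Equiv.Perm (Fin n)) (f : P.Op n),
    equiv n (P.act σ f) = Q.act σ (equiv n f)
  map_one : equiv 1 P.one = Q.one
  map_comp : ∀ {m : ℕ} (n : Fin m → ℕ) (f : P.Op m) (g : ∀ i, P.Op (n i)),
    equiv _ (P.comp n f g) = Q.comp n (equiv m f) fun i => equiv (n i) (g i)

end OperadPresentation

/-! ### Colorings of trees -/

section Colorings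

variable {X : ℕ → Type u} {A : Type v} {Ω : Type z}

/-- A list of the right total length splits into consecutive blocks of given lengths. -/
theorem exists_blocks {n : ℕ} (len : Fin n → ℕ) (l : List Ω)
    (hl : l.length = (List.ofFn len).sum) :
    ∃ b : Fin n → List Ω, (∀ i, (b i).length = len i) ∧ (List.ofFn b).flatten = l := by
  induction n generalizing l with
  | zero => exact ⟨fun i => i.elim0, fun i => i.elim0,
    (List.length_eq_zero_iff.1 (by simpa using hl)).symm⟩
  | succ n ih =>
    rw [List.ofFn_succ, List.sum_cons] at hl
    obtain ⟨b, hb, hb'⟩ := ih (fun i => len i.succ) (l.drop (len 0)) (by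
      rw [List.length_drop]; omega)
    refine ⟨Fin.cons (l.take (len 0)) b, ?_, ?_⟩
    · intro i
      refine Fin.cases ?_ (fun i => ?_) i
      · simp [hl]
      · simp [hb]
    · simp [List.ofFn_succ, hb']

/-- Blocks of given lengths are determined by their concatenation. -/
theorem blocks_ext {n : ℕ} (b b' : Fin n → List Ω) (hlen : ∀ i, (b i).length = (b' i).length)
    (h : (List.ofFn b).flatten = (List.ofFn b').flatten) : b = b' := by
  induction n with
  | zero => exact funext fun i => i.elim0
  | succ n ih =>
    simp only [List.ofFn_succ, List.flatten_cons] at h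
    obtain ⟨h0, h1⟩ := List.append_inj h (hlen 0)
    have := ih (fun i => b i.succ) (fun i => b' i.succ) (fun i => hlen i.succ) h1
    funext i
    refine Fin.cases h0 (fun i => ?_) i
    exact congrFun this i

theorem DTree.exists_coloring (t : DTree X A) (l : List Ω) (hl : l.length = t.weight) :
    ∃ D : DTree (fun n => X n × Ω) A, D.forget = t ∧ D.colors = l := by
  induction t generalizing l with
  | leaf a =>
    refine ⟨.leaf a, rfl, ?_⟩
    simpa [DTree.weight, DTree.colors, eq_comm] using hl
  | node x child ih =>
    cases l with
    | nil =>
      rw [List.length_nil, DTree.weight] at hl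
      omega
    | cons ω l =>
      rw [List.length_cons, DTree.weight] at hl
      obtain ⟨b, hb, rfl⟩ := exists_blocks (fun i => (child i).weight) l (by omega)
      choose D hD hD' using fun i => ih i (b i) (hb i)
      exact ⟨.node (x, ω) D, by simp [DTree.forget, hD], by simp [DTree.colors, hD']⟩

theorem DTree.coloring_ext (D D' : DTree (fun n => X n × Ω) A) (hf : D.forget = D'.forget)
    (hc : D.colors = D'.colors) : D = D' := by
  induction D generalizing D' with
  | leaf a =>
    cases D' with
    | leaf a' => simpa [DTree.forget] using hf
    | node x child => simp [DTree.forget] at hf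
  | node x child ih =>
    cases D' with
    | leaf a' => simp [DTree.forget] at hf
    | @node m x' child' =>
      simp only [DTree.forget, DTree.node.injEq] at hf
      obtain ⟨rfl, hx, hch⟩ := hf
      have hx := eq_of_heq hx
      have hch := congrFun (eq_of_heq hch)
      simp only [DTree.colors, List.cons.injEq] at hc
      have hbl := blocks_ext _ _ (fun i => by
        rw [DTree.length_colors, DTree.length_colors, hch i]) hc.2
      have : child = child' := funext fun i => ih i _ (hch i) (congrFun hbl i)
      subst this
      rw [Prod.ext hx hc.1]

theorem LTree.exists_coloring {n : ℕ} (t : LTree X n) (l : List Ω) (hl : l.length = t.weight) :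
    ∃ D : LTree (fun n => X n × Ω) n, D.forget = t ∧ D.colors = l := by
  obtain ⟨D, hD, hD'⟩ := t.1.exists_coloring l hl
  exact ⟨⟨D, by rw [← D.leaves_forget, hD]; exact t.2⟩, Subtype.ext hD, hD'⟩

theorem LTree.coloring_ext {n : ℕ} (D D' : LTree (fun n => X n × Ω) n)
    (hf : D.forget = D'.forget) (hc : D.colors = D'.colors) : D = D' :=
  Subtype.ext (DTree.coloring_ext _ _ (congrArg Subtype.val hf) hc)

/-- The set of lifts of given type is finite. -/
theorem LTree.finite_lifts {n : ℕ} (t : LTree X n) (c : Ω →₀ ℕ) : (t.Lifts c).Finite := by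
  classical
  refine Set.Finite.of_finite_image (f := LTree.colors) ?_ ?_
  · refine Set.Finite.subset (List.finite_toSet (Finsupp.toMultiset c).toList.permutations) ?_
    rintro _ ⟨D, ⟨-, hD⟩, rfl⟩
    simp only [Set.mem_ofPred_eq, List.mem_permutations]
    rw [← Multiset.coe_eq_coe, Multiset.coe_toList, ← hD, LTree.type,
      Multiset.toFinsupp_toMultiset]
  · rintro D ⟨hD, -⟩ D' ⟨hD', -⟩ h
    exact LTree.coloring_ext _ _ (hD.trans hD'.symm) h

end Colorings

theorem LTree.relabel_relabel {X : ℕ → Type u} {n : ℕ} (σ τ : Equiv.Perm (Fin n)) (t : LTree X n) :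
    (t.relabel σ).relabel τ = t.relabel (τ * σ) := by
  have h : ∀ D : DTree X (Fin n), (D.mapLeaf σ).mapLeaf τ = D.mapLeaf ⇑(τ * σ) := by
    intro D
    induction D with
    | leaf a => rfl
    | node x child ih => exact congrArg (DTree.node x) (funext ih)
  exact Subtype.ext (h t.1)

theorem LTree.relabel_one {X : ℕ → Type u} {n : ℕ} (t : LTree X n) : t.relabel 1 = t := by
  have h : ∀ D : DTree X (Fin n), D.mapLeaf ⇑(1 : Equiv.Perm (Fin n)) = D := by
    intro D
    induction D with
    | leaf a => rfl
    | node x child ih => exact congrArg (DTree.node x) (funext ih)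
  exact Subtype.ext (h t.1)

theorem LTree.forget_relabel {X : ℕ → Type u} {Ω : Type z} {n : ℕ} (σ : Equiv.Perm (Fin n))
    (D : LTree (fun n => X n × Ω) n) : (D.relabel σ).forget = D.forget.relabel σ := by
  have h : ∀ D : DTree (fun n => X n × Ω) (Fin n),
      (D.mapLeaf σ).forget = D.forget.mapLeaf σ := by
    intro D
    induction D with
    | leaf a => rfl
    | node x child ih => exact congrArg (DTree.node x.1) (funext ih)
  exact Subtype.ext (h D.1)

theorem LTree.colors_relabel {X : ℕ → Type u} {Ω : Type z} {n : ℕ} (σ : Equiv.Perm (Fin n))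
    (D : LTree (fun n => X n × Ω) n) : (D.relabel σ).colors = D.colors := by
  have h : ∀ D : DTree (fun n => X n × Ω) (Fin n), (D.mapLeaf σ).colors = D.colors := by
    intro D
    induction D with
    | leaf a => rfl
    | node x child ih =>
      exact congrArg (fun b => x.2 :: (List.ofFn b).flatten) (funext ih)
  exact h D.1

theorem Free.act_apply {k : Type w} [Field k] {X : ℕ → Type u} {n : ℕ} (σ : Equiv.Perm (Fin n))
    (f : Free k X n) (t : LTree X n) : f.act σ t = f (t.relabel σ) := by
  have h : t = (t.relabel σ).relabel σ⁻¹ := by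
    rw [LTree.relabel_relabel, inv_mul_cancel, LTree.relabel_one]
  conv_lhs => rw [h]
  refine Finsupp.mapDomain_apply (fun t t' htt => ?_) f _
  rw [← t.relabel_one, ← t'.relabel_one, ← mul_inv_cancel σ, ← LTree.relabel_relabel,
    ← LTree.relabel_relabel, htt]

/-! ### Quasipolarizations, foliations and compatibilities -/

section Compatibilities

variable {k : Type w} [Field k] {X : ℕ → Type u} {Ω : Type z} {n : ℕ}

/-- The quasipolarization of `f` of type `c`, that is, the coefficient of the monomial `λ^c` in the
expansion of `f` after the substitution `x ↦ ∑ ω, λ_ω x_ω`: every decorated tree is replaced by the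
(finite) sum of its lifts of type `c`. -/
noncomputable def quasipolarization (f : Free k X n) (c : Ω →₀ ℕ) :
    Free k (fun n => X n × Ω) n :=
  f.sum fun t a => a • ∑ᶠ D ∈ t.Lifts c, Finsupp.single D 1

/-- A foliation of the quasipolarization of type `c` of `f = ∑ α_t t`: the lifts of type `c` of each
tree `t` in the support of `f` are listed, without repetition, as `col t 0, …, col t (size - 1)`.
The parts of the foliation are the sums `∑ α_t (col t j)`. -/
structure Foliation (f : Free k X n) (c : Ω →₀ ℕ) where
  size : ℕ
  size_pos : 0 < size
  col : ∀ t : f.support, Fin size ≃ t.1.Lifts c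

namespace Foliation

variable {f : Free k X n} {c : Ω →₀ ℕ}

/-- The `j`-th part of a foliation. -/
noncomputable def part (F : Foliation f c) (j : Fin F.size) : Free k (fun n => X n × Ω) n :=
  ∑ t : f.support, f t.1 • Finsupp.single (F.col t j).1 1

/-- The set of the parts of a foliation. -/
def parts (F : Foliation f c) : Set (Free k (fun n => X n × Ω) n) := Set.range F.part

/-- The foliation is leveled: within each part, the `i`-th vertices (in preorder) of any two
trees have the same color, for all `i`. -/
def IsLeveled (F : Foliation f c) : Prop :=
  ∀ (j : Fin F.size) (t t' : f.support), (F.col t j).1.colors = (F.col t' j).1.colors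

end Foliation

/-- A matching compatibility: a choice of a foliation of each quasipolarization of each homogeneous
relation `r`, subject to the condition that the matching relations of `r · ρ` are those of `r`
acted upon by `ρ`. -/
structure MatchingCompat (P : OperadPresentation.{u} k) (Ω : Type z) where
  foliation : ∀ {n m : ℕ} (r : Free k P.gen n), r ∈ P.rel n → r.IsHomogeneous m →
    ∀ c : Ω →₀ ℕ, c.degree = m → Foliation r c
  act_parts : ∀ {n m : ℕ} (r : Free k P.gen n) (hr : r ∈ P.rel n) (hm : r.IsHomogeneous m)
    (ρ : Equiv.Perm (Fin n)) (hr' : r.act ρ ∈ P.rel n) (hm' : (r.act ρ).IsHomogeneous m),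
    (⋃ (c : Ω →₀ ℕ) (hc : c.degree = m), Free.act ρ '' (foliation r hr hm c hc).parts) =
      ⋃ (c : Ω →₀ ℕ) (hc : c.degree = m), (foliation (r.act ρ) hr' hm' c hc).parts

namespace MatchingCompat

variable {P : OperadPresentation.{u} k}

/-- The matching relations. -/
def rel (S : MatchingCompat P Ω) (n : ℕ) : Set (Free k (fun n => P.gen n × Ω) n) :=
  {g | ∃ (m : ℕ) (r : Free k P.gen n) (hr : r ∈ P.rel n) (hm : r.IsHomogeneous m) (c : Ω →₀ ℕ)
    (hc : c.degree = m), g ∈ (S.foliation r hr hm c hc).parts}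

/-- The matching compatibility is leveled. -/
def IsLeveled (S : MatchingCompat P Ω) : Prop :=
  ∀ {n m : ℕ} (r : Free k P.gen n) (hr : r ∈ P.rel n) (hm : r.IsHomogeneous m) (c : Ω →₀ ℕ)
    (hc : c.degree = m), (S.foliation r hr hm c hc).IsLeveled

end MatchingCompat

open Classical in
/-- Leveled matching compatibilities exist; every homogeneous relation `r` of weight `m` and every
list `l` of `m` colors contribute the matching relation in which the vertices of each tree of `r`
are colored, in preorder, by `l`. -/
theorem MatchingCompat.exists_leveled {k : Type w} [Field k] {Ω : Type z}
    (P : OperadPresentation.{u} k) : ∃ S : MatchingCompat P Ω, S.IsLeveled ∧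
    (∀ {n m : ℕ} (r : Free k P.gen n), r ∈ P.rel n → r.IsHomogeneous m → ∀ l : List Ω,
      l.length = m → ∃ g ∈ S.rel n, ∀ D : LTree (fun n => P.gen n × Ω) n,
        g D = if D.colors = l then r D.forget else 0) := by
  classical
  let L : (Ω →₀ ℕ) → Set (List Ω) := fun c => {l | Multiset.toFinsupp (l : Multiset Ω) = c}
  have hLlen : ∀ c, ∀ l ∈ L c, l.length = c.degree := by
    rintro c l rfl
    have := congrArg Multiset.card (Multiset.toFinsupp_toMultiset (l : Multiset Ω))
    rw [Finsupp.card_toMultiset] at this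
    rw [Multiset.coe_card] at this
    exact this.symm
  have hLfin : ∀ c, (L c).Finite := by
    intro c
    refine Set.Finite.subset (List.finite_toSet (Finsupp.toMultiset c).toList.permutations) ?_
    rintro l rfl
    simp only [Set.mem_ofPred_eq, List.mem_permutations]
    rw [← Multiset.coe_eq_coe, Multiset.coe_toList, Multiset.toFinsupp_toMultiset]
  have hLne : ∀ c, (L c).Nonempty := fun c => ⟨(Finsupp.toMultiset c).toList, by
    simp [L]⟩
  have : ∀ c, Finite (L c) := fun c => (hLfin c).to_subtype
  have e : ∀ c, Fin (Nat.card (L c)) ≃ L c := fun c => (Finite.equivFin _).symm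
  have exq : ∀ {X : ℕ → Type u} {n : ℕ} (t : LTree X n) (c : Ω →₀ ℕ) (_ : c.degree = t.weight),
      ∃ q : L c ≃ t.Lifts c, ∀ l, (q l).1.colors = l.1 := by
    intro X n t c hc
    choose D hD hD' using fun l : L c => t.exists_coloring l.1 ((hLlen c _ l.2).trans hc)
    refine ⟨Equiv.ofBijective (fun l => ⟨D l, hD l, by rw [LTree.type, hD']; exact l.2⟩)
      ⟨?_, ?_⟩, ?_⟩
    · intro l l' h
      have : D l = D l' := congrArg Subtype.val h
      exact Subtype.ext (by rw [← hD' l, ← hD' l', this])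
    · rintro ⟨D0, h1, h2⟩
      refine ⟨⟨D0.colors, h2⟩, Subtype.ext (LTree.coloring_ext _ _ ?_ ?_)⟩
      · exact (hD _).trans h1.symm
      · exact hD' _
    · exact hD'
  choose q hq using fun {X : ℕ → Type u} {n : ℕ} => @exq X n
  let F : ∀ {n m : ℕ} (r : Free k P.gen n), r ∈ P.rel n → r.IsHomogeneous m →
    ∀ c : Ω →₀ ℕ, c.degree = m → Foliation r c := fun {n m} r hr hm c hc =>
    { size := Nat.card (L c)
      size_pos := by
        have : Nonempty (L c) := (hLne c).to_subtype
        exact Nat.card_pos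
      col := fun t => (e c).trans (q t.1 c (hc.trans (hm t.1 t.2).symm)) }
  have hpart : ∀ {n m : ℕ} (r : Free k P.gen n) (hr : r ∈ P.rel n) (hm : r.IsHomogeneous m)
      (c : Ω →₀ ℕ) (hc : c.degree = m) (j) (D), (F r hr hm c hc).part j D =
        if D.colors = (e c j).1 then r D.forget else 0 := by
    intro n m r hr hm c hc j D
    have hcol : ∀ t, ((F r hr hm c hc).col t j).1.colors = (e c j).1 := fun t => hq _ _ _ _
    have hfor : ∀ t, ((F r hr hm c hc).col t j).1.forget = t.1 :=
      fun t => ((F r hr hm c hc).col t j).2.1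
    rw [Foliation.part, Finsupp.finsetSum_apply]
    split_ifs with h
    · by_cases hs : D.forget ∈ r.support
      · rw [Finset.sum_eq_single ⟨_, hs⟩]
        · have : ((F r hr hm c hc).col ⟨_, hs⟩ j).1 = D :=
            LTree.coloring_ext _ _ (hfor _) ((hcol _).trans h.symm)
          simp [this]
        · intro t _ ht
          rw [Finsupp.smul_apply, Finsupp.single_apply, if_neg, smul_zero]
          intro h'
          exact ht (Subtype.ext (by rw [← hfor t, h']))
        · simp
      · rw [Finset.sum_eq_zero]
        · simpa using (Finsupp.notMem_support_iff.1 hs).symm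
        · intro t _
          rw [Finsupp.smul_apply, Finsupp.single_apply, if_neg, smul_zero]
          intro h'
          exact hs (by rw [← h', hfor t]; exact t.2)
    · rw [Finset.sum_eq_zero]
      intro t _
      rw [Finsupp.smul_apply, Finsupp.single_apply, if_neg, smul_zero]
      intro h'
      exact h (by rw [← h', hcol t])
  refine ⟨⟨F, ?_⟩, ?_, ?_⟩
  · intro n m r hr hm ρ hr' hm'
    have key : ∀ (c : Ω →₀ ℕ) (hc : c.degree = m) (j),
        Free.act ρ ((F r hr hm c hc).part j) = (F (r.act ρ) hr' hm' c hc).part j := by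
      intro c hc j
      ext D
      rw [Free.act_apply, hpart r hr hm c hc, hpart (r.act ρ) hr' hm' c hc, D.colors_relabel,
        D.forget_relabel, Free.act_apply]
    ext g
    simp only [Set.mem_iUnion, Set.mem_image, Foliation.parts, Set.mem_range]
    constructor
    · rintro ⟨c, hc, _, ⟨j, rfl⟩, rfl⟩
      exact ⟨c, hc, j, (key c hc j).symm⟩
    · rintro ⟨c, hc, j, rfl⟩
      exact ⟨c, hc, _, ⟨j, rfl⟩, key c hc j⟩
  · intro n m r hr hm c hc j t t'
    exact (hq _ _ _ _).trans (hq _ _ _ _).symm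
  · intro n m r hr hm l hl
    let c : Ω →₀ ℕ := Multiset.toFinsupp (l : Multiset Ω)
    have hlc : l ∈ L c := rfl
    have hc : c.degree = m := (hLlen c l hlc).symm.trans hl
    refine ⟨(F r hr hm c hc).part ((e c).symm ⟨l, hlc⟩), ⟨m, r, hr, hm, c, hc, _, rfl⟩, ?_⟩
    intro D
    rw [hpart r hr hm c hc, Equiv.apply_symm_apply]

namespace OperadPresentation

/-- The linearly compatible operad of `P` with parameter set `Ω`. Its relations are all
quasipolarizations of the homogeneous relations of `P`. -/
noncomputable def lin (P : OperadPresentation.{u} k) (Ω : Type z) : OperadPresentation k where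
  gen n := P.gen n × Ω
  reduced := haveI := P.reduced; inferInstance
  rel n := {g | ∃ (m : ℕ) (r : Free k P.gen n) (c : Ω →₀ ℕ), r ∈ P.rel n ∧ r.IsHomogeneous m ∧
    c.degree = m ∧ g = quasipolarization r c}

/-- The leveled matching operad of `P` with parameter set `Ω`. Its relations are the matching
relations of the leveled matching compatibility (it exists by `MatchingCompat.exists_leveled`). -/
noncomputable def lmt (P : OperadPresentation.{u} k) (Ω : Type z) : OperadPresentation k where
  gen n := P.gen n × Ω
  reduced := haveI := P.reduced; inferInstance
  rel n := {g | ∃ S : MatchingCompat P Ω, S.IsLeveled ∧ g ∈ S.rel n}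

end OperadPresentation

end Compatibilities

end OperadCompat

/-! Both constructions have a description by coefficients. Let `r` be a homogeneous relation of
weight `m`. The quasipolarization of type `c` is the function on colored trees `D` that equals `r
D.forget` if `D.type = c` and `0` otherwise (`quasipolarization_apply`). A leveled foliation has one
color list `l` per part, and a colored tree is determined by its underlying tree and its colors in
preorder; so each part is the function equal to `r D.forget` if `D.colors = l` and `0` otherwise
(`IsColoring`). Conversely, every list `l` of length `m` occurs, so the leveled relations are
exactly these colorings.

Iterating stacks such conditions on trees with two colors per vertex. For LMT of Lin and for Lin of
LMT they are the same two: the matching colors form `l` and the linear colors have type `c`. They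
involve different colors, so their order is irrelevant and exchanging the colors carries relations
to relations (`IsColoring.map_swapColors`). For LMT of LMT, prescribing the lists `l` and `l'`
amounts to prescribing the list of pairs `l.zip l'` (`IsColoring.map_pairColors`).

Hence a bijection of generators matches the nonzero relations, which gives an isomorphism of operads
(`exists_iso_of_rel`). The zero relation is set aside: it is homogeneous of every weight, so the
weights at the two stages of the iteration need not agree for it, but it contributes nothing to an
ideal. -/

namespace OperadCompat

/-! ### Changing the decorations of trees -/

section MapDec

variable {X : ℕ → Type u} {Y : ℕ → Type v} {Z : ℕ → Type w} {A : Type*} {B : Type*} {Ω : Type z}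

/-- Change the decorations of the internal vertices along `e`. -/
def DTree.mapDec (e : ∀ n, X n → Y n) : DTree X A → DTree Y A
  | leaf a => leaf a
  | node x child => node (e _ x) fun i => (child i).mapDec e

theorem DTree.leaves_mapDec (e : ∀ n, X n → Y n) (t : DTree X A) :
    (t.mapDec e).leaves = t.leaves := by
  induction t with
  | leaf a => rfl
  | node x child ih => simp only [mapDec, leaves, ih]

theorem DTree.mapDec_mapDec (e : ∀ n, X n → Y n) (e' : ∀ n, Y n → Z n) (t : DTree X A) :
    (t.mapDec e).mapDec e' = t.mapDec fun n x => e' n (e n x) := by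
  induction t with
  | leaf a => rfl
  | node x child ih => simp only [mapDec, ih]

theorem DTree.mapDec_id (t : DTree X A) : t.mapDec (fun _ x => x) = t := by
  induction t with
  | leaf a => rfl
  | node x child ih => simp only [mapDec, ih]

theorem DTree.mapDec_subst (e : ∀ n, X n → Y n) (s : A → DTree X B) (t : DTree X A) :
    (t.subst s).mapDec e = (t.mapDec e).subst fun a => (s a).mapDec e := by
  induction t with
  | leaf a => rfl
  | node x child ih => simp only [subst, mapDec, ih]

theorem DTree.mapDec_mapLeaf (e : ∀ n, X n → Y n) (f : A → B) (t : DTree X A) :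
    (t.mapLeaf f).mapDec e = (t.mapDec e).mapLeaf f :=
  DTree.mapDec_subst e _ t

theorem DTree.weight_forget (t : DTree (fun n => X n × Ω) A) : t.forget.weight = t.weight := by
  induction t with
  | leaf a => rfl
  | node x child ih => simp only [forget, weight, ih]

namespace LTree

variable {n : ℕ}

/-- Change the decorations of the internal vertices along `e`. -/
def mapDec (e : ∀ n, X n → Y n) (t : LTree X n) : LTree Y n :=
  ⟨t.1.mapDec e, by rw [DTree.leaves_mapDec]; exact t.2⟩

theorem mapDec_mapDec (e : ∀ n, X n → Y n) (e' : ∀ n, Y n → Z n) (t : LTree X n) :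
    (t.mapDec e).mapDec e' = t.mapDec fun n x => e' n (e n x) :=
  Subtype.ext (t.1.mapDec_mapDec e e')

theorem mapDec_id (t : LTree X n) : t.mapDec (fun _ x => x) = t :=
  Subtype.ext t.1.mapDec_id

theorem mapDec_relabel (e : ∀ n, X n → Y n) (σ : Equiv.Perm (Fin n)) (t : LTree X n) :
    (t.relabel σ).mapDec e = (t.mapDec e).relabel σ :=
  Subtype.ext (t.1.mapDec_mapLeaf e σ)

theorem mapDec_graft (e : ∀ n, X n → Y n) {m : ℕ} {n : Fin m → ℕ} (t : LTree X m)
    (s : ∀ i, LTree X (n i)) :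
    (t.graft s).mapDec e = (t.mapDec e).graft fun i => (s i).mapDec e := by
  refine Subtype.ext ((DTree.mapDec_subst e _ t.1).trans ?_)
  exact congrArg (t.1.mapDec e).subst (funext fun i => DTree.mapDec_mapLeaf e _ (s i).1)

theorem weight_forget (D : LTree (fun n => X n × Ω) n) : D.forget.weight = D.weight :=
  D.1.weight_forget

theorem length_colors (D : LTree (fun n => X n × Ω) n) : D.colors.length = D.weight :=
  D.1.length_colors.trans D.1.weight_forget

theorem type_eq_of_colors_eq {D : LTree (fun n => X n × Ω) n} {D' : LTree (fun n => Y n × Ω) n}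
    (h : D.colors = D'.colors) : D.type = D'.type := by
  rw [type, type, h]

end LTree

end MapDec

/-! ### Functoriality of the free operad in its generators -/

section MapFree

variable {k : Type w} [Field k] {X : ℕ → Type u} {Y : ℕ → Type v}

/-- The morphism of free operads induced by a map of generating operations. -/
noncomputable def Free.map (e : ∀ n, X n → Y n) (n : ℕ) : Free k X n →ₗ[k] Free k Y n :=
  Finsupp.lmapDomain k k (LTree.mapDec e)

theorem Free.map_single (e : ∀ n, X n → Y n) {n : ℕ} (t : LTree X n) (a : k) :
    Free.map e n (Finsupp.single t a) = Finsupp.single (t.mapDec e) a :=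
  Finsupp.mapDomain_single

theorem Free.map_act (e : ∀ n, X n → Y n) {n : ℕ} (σ : Equiv.Perm (Fin n)) (f : Free k X n) :
    Free.map e n (f.act σ) = (Free.map e n f).act σ := by
  simp only [Free.map, Free.act, Finsupp.lmapDomain_apply]
  rw [← Finsupp.mapDomain_comp, ← Finsupp.mapDomain_comp]
  congr 1
  exact funext fun t => t.mapDec_relabel e σ⁻¹

theorem Free.map_one (e : ∀ n, X n → Y n) : Free.map e 1 (Free.one : Free k X 1) = Free.one :=
  Free.map_single e _ _

theorem Free.map_of (e : ∀ n, X n → Y n) {n : ℕ} (x : X n) :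
    Free.map e n (Free.of x : Free k X n) = Free.of (e n x) :=
  Free.map_single e _ _

/-- By linearity in `f` and multilinearity in `g` it suffices to take single trees, where the claim
is that redecorating commutes with grafting. -/
theorem Free.map_comp (e : ∀ n, X n → Y n) {m : ℕ} (n : Fin m → ℕ) (f : Free k X m)
    (g : ∀ i, Free k X (n i)) :
    Free.map e _ (Free.comp n f g) =
      Free.comp n (Free.map e m f) fun i => Free.map e (n i) (g i) := by
  induction f using Finsupp.induction_linear with
  | zero => simp
  | add f f' h h' => simp only [map_add, add_apply, h, h']
  | single t a =>
    have h1 : Finsupp.single t a = a • Finsupp.single t (1 : k) := by simp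
    have key : (Free.map e _).compMultilinearMap (Free.comp n (Finsupp.single t (1 : k))) =
        (Free.comp n (Free.map e m (Finsupp.single t (1 : k)))).compLinearMap
          fun i => Free.map e (n i) := by
      refine Module.Basis.ext_multilinear (fun i => Finsupp.basisSingleOne) fun s => ?_
      simp only [Finsupp.coe_basisSingleOne, LinearMap.compMultilinearMap_apply,
        MultilinearMap.compLinearMap_apply, Free.map_single, Free.comp_single,
        LTree.mapDec_graft]
    rw [h1]
    simp only [map_smul, smul_apply]
    exact congrArg (a • ·) (congrArg (fun F => F g) key)

theorem Free.map_map_of_leftInverse {e : ∀ n, X n → Y n} {e' : ∀ n, Y n → X n}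
    (h : ∀ n x, e' n (e n x) = x) {n : ℕ} (f : Free k X n) :
    Free.map e' n (Free.map e n f) = f := by
  simp only [Free.map, Finsupp.lmapDomain_apply]
  rw [← Finsupp.mapDomain_comp]
  refine (congrArg (fun F => Finsupp.mapDomain F f) (funext fun t => ?_)).trans
    Finsupp.mapDomain_id
  simp only [Function.comp_apply, LTree.mapDec_mapDec, h, LTree.mapDec_id, id]

theorem Free.map_mapDec_apply {e : ∀ n, X n → Y n} {e' : ∀ n, Y n → X n}
    (h : ∀ n x, e' n (e n x) = x) {n : ℕ} (f : Free k X n) (t : LTree X n) :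
    Free.map e n f (t.mapDec e) = f t := by
  refine Finsupp.mapDomain_apply (Function.LeftInverse.injective (g := LTree.mapDec e') ?_) f t
  intro t
  simp only [LTree.mapDec_mapDec, h, LTree.mapDec_id]

/-- For bijective `e` every tree over `Y` is a redecorated tree over `X`, so coefficients can be
compared there. All identities between relations below are proved in this way. -/
theorem Free.map_eq_of_apply {e : ∀ n, X n → Y n} {e' : ∀ n, Y n → X n}
    (h : ∀ n x, e' n (e n x) = x) (h' : ∀ n y, e n (e' n y) = y) {n : ℕ} {f : Free k X n}
    {g : Free k Y n} (hfg : ∀ t, g (t.mapDec e) = f t) : Free.map e n f = g := by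
  ext t
  have ht : (t.mapDec e').mapDec e = t := by
    simp only [LTree.mapDec_mapDec, h', LTree.mapDec_id]
  rw [← ht, Free.map_mapDec_apply h, hfg]

/-- The preimage of an operadic ideal. -/
noncomputable def OperadicIdeal.comap (e : ∀ n, X n → Y n) (I : OperadicIdeal k Y) :
    OperadicIdeal k X where
  carrier n := (I.carrier n).comap (Free.map e n)
  act_mem σ f hf := by
    rw [Submodule.mem_comap, Free.map_act]
    exact I.act_mem σ _ hf
  comp_mem_left n f g hf := by
    rw [Submodule.mem_comap, Free.map_comp]
    exact I.comp_mem_left n _ _ hf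
  comp_mem_right n f g i hg := by
    rw [Submodule.mem_comap, Free.map_comp]
    exact I.comp_mem_right n _ _ i hg

theorem OperadicIdeal.subset_span (R : ∀ n, Set (Free k X n)) (n : ℕ) :
    R n ⊆ (OperadicIdeal.span R).carrier n := by
  intro f hf
  simp only [OperadicIdeal.span, SetLike.mem_coe, Submodule.mem_iInf]
  exact fun I hI => hI n hf

theorem OperadicIdeal.span_le {R : ∀ n, Set (Free k X n)} {I : OperadicIdeal k X}
    (h : ∀ n, R n ⊆ I.carrier n) (n : ℕ) : (OperadicIdeal.span R).carrier n ≤ I.carrier n :=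
  iInf₂_le I h

end MapFree

/-! ### Isomorphisms induced by bijections of generators -/

namespace OperadPresentation

variable {k : Type w} [Field k]

/-- The preimage of the ideal of `Q` is an operadic ideal containing the relations of `P`, so it
contains the ideal they generate. The relation `0` needs no hypothesis. -/
theorem map_mem_ideal {P : OperadPresentation.{u} k} {Q : OperadPresentation.{v} k}
    (e : ∀ n, P.gen n → Q.gen n)
    (h : ∀ n, ∀ r ∈ P.rel n, r ≠ 0 → Free.map e n r ∈ Q.rel n)
    {n : ℕ} {f : Free k P.gen n} (hf : f ∈ P.ideal.carrier n) :
    Free.map e n f ∈ Q.ideal.carrier n := by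
  refine OperadicIdeal.span_le (I := Q.ideal.comap e) (fun n r hr => ?_) n hf
  by_cases h0 : r = 0
  · rw [h0]
    exact Submodule.zero_mem _
  · exact OperadicIdeal.subset_span Q.rel n (h n r hr h0)

/-- A bijection between the generating operations that identifies the nonzero relations induces an
isomorphism of the presented operads. -/
theorem exists_iso_of_rel {P : OperadPresentation.{u} k} {Q : OperadPresentation.{v} k}
    (e : ∀ n, P.gen n → Q.gen n) (e' : ∀ n, Q.gen n → P.gen n)
    (he : ∀ n x, e' n (e n x) = x) (he' : ∀ n y, e n (e' n y) = y)
    (h : ∀ n, ∀ r ∈ P.rel n, r ≠ 0 → Free.map e n r ∈ Q.rel n)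
    (h' : ∀ n, ∀ r ∈ Q.rel n, r ≠ 0 → Free.map e' n r ∈ P.rel n) :
    ∃ φ : Iso P Q, ∀ (n : ℕ) (x : P.gen n), φ.equiv n (P.of x) = Q.of (e n x) := by
  let F : ∀ n, Free k P.gen n ≃ₗ[k] Free k Q.gen n := fun n =>
    LinearEquiv.ofLinearMap (Free.map e n) (Free.map e' n)
      (LinearMap.ext fun f => Free.map_map_of_leftInverse he' f)
      (LinearMap.ext fun f => Free.map_map_of_leftInverse he f)
  have hF : ∀ n, (P.ideal.carrier n).map (F n).toLinearMap = Q.ideal.carrier n := by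
    intro n
    apply le_antisymm
    · rintro _ ⟨f, hf, rfl⟩
      exact map_mem_ideal e h hf
    · intro g hg
      exact ⟨Free.map e' n g, map_mem_ideal e' h' hg, Free.map_map_of_leftInverse he' g⟩
  let E : ∀ n, P.Op n ≃ₗ[k] Q.Op n := fun n => Submodule.Quotient.equiv _ _ (F n) (hF n)
  have hE : ∀ {n : ℕ} (f : Free k P.gen n), E n (P.proj f) = Q.proj (Free.map e n f) :=
    fun f => rfl
  refine ⟨⟨E, ?_, ?_, ?_⟩, ?_⟩
  · intro n σ f
    rw [← P.proj_out f]
    -- On classes of representatives both actions are by definition computed in the free operad.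
    change E n (P.proj (Free.act σ _)) = Q.proj (Free.act σ _)
    rw [hE, Free.map_act]
    rfl
  · rw [one, hE, Free.map_one, one]
  · intro m n f g
    have hg : g = fun i => P.proj (Quotient.out (g i)) := funext fun i => (P.proj_out _).symm
    rw [← P.proj_out f, hg, comp_proj, hE, Free.map_comp, hE]
    simp only [hE]
    rw [comp_proj]
  · intro n x
    rw [of, of]
    exact (hE _).trans (by rw [Free.map_of])

end OperadPresentation

/-! ### The relations of the two constructions -/

section Relations

variable {k : Type w} [Field k] {X : ℕ → Type u} {Ω : Type z} {n : ℕ}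

theorem Free.IsHomogeneous.weight_eq {f : Free k X n} {m : ℕ} (hf : f.IsHomogeneous m)
    {t : LTree X n} (ht : f t ≠ 0) : t.weight = m :=
  hf t (Finsupp.mem_support_iff.2 ht)

/-- Any tree of the support has both weights. This fails for `f = 0`, which is why zero relations
are treated apart. -/
theorem Free.IsHomogeneous.eq {f : Free k X n} {m m' : ℕ} (hm : f.IsHomogeneous m)
    (hm' : f.IsHomogeneous m') (h : f ≠ 0) : m = m' := by
  obtain ⟨t, ht⟩ := Finsupp.support_nonempty_iff.2 h
  rw [← hm t ht, hm' t ht]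

-- A colored tree `D` is a lift of `D.forget` and of no other tree, so at most one term of the sum
-- contributes to its coefficient.
open Classical in
theorem quasipolarization_apply (f : Free k X n) (c : Ω →₀ ℕ) (D : LTree (fun n => X n × Ω) n) :
    quasipolarization f c D = if D.type = c then f D.forget else 0 := by
  have hsum : ∀ t : LTree X n, (∑ᶠ D ∈ t.Lifts c, Finsupp.single D (1 : k)) D =
      if D ∈ t.Lifts c then 1 else 0 := by
    intro t
    rw [finsum_mem_eq_finite_toFinset_sum _ (t.finite_lifts c), Finsupp.finsetSum_apply]
    simp [Finsupp.single_apply]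
  rw [quasipolarization, Finsupp.sum_apply, Finsupp.sum]
  simp only [Finsupp.smul_apply, hsum]
  by_cases hc : D.type = c
  · simpa [hc, LTree.Lifts] using fun h => h.symm
  · simp [hc, LTree.Lifts]

open Classical in
/-- `g` colors the trees of `f` by `l`, in preorder. -/
def IsColoring (f : Free k X n) (l : List Ω) (g : Free k (fun n => X n × Ω) n) : Prop :=
  ∀ D, g D = if D.colors = l then f D.forget else 0

theorem IsColoring.ne_zero {f : Free k X n} {l : List Ω} {g : Free k (fun n => X n × Ω) n}
    (h : IsColoring f l g) (hg : g ≠ 0) : f ≠ 0 := by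
  rintro rfl
  exact hg (Finsupp.ext fun D => by simp [h D])

theorem IsColoring.isHomogeneous {f : Free k X n} {l : List Ω} {g : Free k (fun n => X n × Ω) n}
    (h : IsColoring f l g) {m : ℕ} (hf : f.IsHomogeneous m) : g.IsHomogeneous m := by
  classical
  intro D hD
  rw [Finsupp.mem_support_iff, h] at hD
  rw [← LTree.weight_forget]
  exact hf.weight_eq (ite_ne_right_iff.1 hD).2

theorem isHomogeneous_quasipolarization {f : Free k X n} {m : ℕ} (hf : f.IsHomogeneous m)
    (c : Ω →₀ ℕ) : (quasipolarization f c).IsHomogeneous m := by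
  classical
  intro D hD
  rw [Finsupp.mem_support_iff, quasipolarization_apply] at hD
  rw [← LTree.weight_forget]
  exact hf.weight_eq (ite_ne_right_iff.1 hD).2

/-- All trees of a part share the color list `l` of any one of them. A tree colored by `l` over a
tree `t` of `f` is the lift of `t` in that part, since underlying tree and colors determine it. -/
theorem Foliation.IsLeveled.exists_isColoring [Nonempty Ω] {f : Free k X n} {m : ℕ}
    (hf : f.IsHomogeneous m) {c : Ω →₀ ℕ} {F : Foliation f c} (hF : F.IsLeveled)
    (j : Fin F.size) : ∃ l : List Ω, l.length = m ∧ IsColoring f l (F.part j) := by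
  classical
  rcases isEmpty_or_nonempty f.support with h | ⟨⟨t₀⟩⟩
  · have hf0 : f = 0 := by
      rw [← Finsupp.support_eq_empty]
      exact Finset.isEmpty_coe_sort.1 h
    -- With `f = 0` no tree supplies a color list; any list of length `m` serves, and `Ω` must be
    -- nonempty for one to exist when `m > 0`.
    refine ⟨List.replicate m (Classical.arbitrary Ω), List.length_replicate, fun D => ?_⟩
    have : F.part j = 0 := Finset.sum_eq_zero fun t _ => (h.false t).elim
    rw [this, hf0]
    simp
  · have hfor : ∀ t, (F.col t j).1.forget = t.1 := fun t => (F.col t j).2.1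
    refine ⟨(F.col t₀ j).1.colors, ?_, fun D => ?_⟩
    · rw [LTree.length_colors, ← LTree.weight_forget, hfor]
      exact hf _ t₀.2
    rw [Foliation.part, Finsupp.finsetSum_apply]
    have hzero : ∀ t : f.support, (F.col t j).1 ≠ D →
        (f t.1 • Finsupp.single (F.col t j).1 (1 : k)) D = 0 := fun t ht => by
      rw [Finsupp.smul_apply, Finsupp.single_eq_of_ne ht.symm, smul_zero]
    split_ifs with h
    · by_cases hs : D.forget ∈ f.support
      · have hD : (F.col ⟨_, hs⟩ j).1 = D :=
          LTree.coloring_ext _ _ (hfor _) ((hF j _ _).trans h.symm)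
        rw [Finset.sum_eq_single ⟨_, hs⟩]
        · simp [hD]
        · intro t _ ht
          exact hzero t fun h' => ht (Subtype.ext (by rw [← hfor t, h']))
        · simp
      · rw [Finsupp.notMem_support_iff.1 hs]
        refine Finset.sum_eq_zero fun t _ => hzero t fun h' => hs ?_
        rw [← h', hfor t]
        exact t.2
    · exact Finset.sum_eq_zero fun t _ => hzero t fun h' => h (by rw [← h', hF j t t₀])

namespace OperadPresentation

variable {P : OperadPresentation.{u} k}

/-- The description by color lists applies to every leveled compatibility, so with the converse
`exists_mem_lmt_rel` the relations do not depend on how the foliations enumerate the lifts. -/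
theorem exists_isColoring_of_mem_lmt_rel [Nonempty Ω] {g : Free k (P.lmt Ω).gen n}
    (hg : g ∈ (P.lmt Ω).rel n) : ∃ (m : ℕ) (r : Free k P.gen n) (l : List Ω),
      r ∈ P.rel n ∧ r.IsHomogeneous m ∧ l.length = m ∧ IsColoring r l g := by
  obtain ⟨S, hS, m, r, hr, hm, c, hc, j, rfl⟩ := hg
  obtain ⟨l, hl, hl'⟩ := (hS r hr hm c hc).exists_isColoring hm j
  exact ⟨m, r, l, hr, hm, hl, hl'⟩

theorem exists_mem_lmt_rel {m : ℕ} {r : Free k P.gen n} (hr : r ∈ P.rel n)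
    (hm : r.IsHomogeneous m) {l : List Ω} (hl : l.length = m) :
    ∃ g ∈ (P.lmt Ω).rel n, IsColoring r l g := by
  obtain ⟨S, hS, h⟩ := MatchingCompat.exists_leveled (Ω := Ω) P
  obtain ⟨g, hg, hg'⟩ := h r hr hm l hl
  refine ⟨g, ⟨S, hS, hg⟩, fun D => ?_⟩
  rw [hg' D]

end OperadPresentation

end Relations

/-! ### Exchanging and pairing colors -/

section Colors

variable {X : ℕ → Type u} {A : Type*} {Ω : Type v} {Ω' : Type w} {n : ℕ}

/-- Exchange the two colors of a decoration. -/
def swapColors (X : ℕ → Type u) (Ω : Type v) (Ω' : Type w) (n : ℕ) (x : (X n × Ω) × Ω') :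
    (X n × Ω') × Ω :=
  ((x.1.1, x.2), x.1.2)

/-- Combine the two colors of a decoration. -/
def pairColors (X : ℕ → Type u) (Ω : Type v) (Ω' : Type w) (n : ℕ) (x : (X n × Ω) × Ω') :
    X n × (Ω × Ω') :=
  (x.1.1, (x.1.2, x.2))

/-- Separate the two colors of a decoration. -/
def unpairColors (X : ℕ → Type u) (Ω : Type v) (Ω' : Type w) (n : ℕ) (x : X n × (Ω × Ω')) :
    (X n × Ω) × Ω' :=
  ((x.1, x.2.1), x.2.2)

namespace DTree

/-- In a doubly colored tree, `colors` reads the outer color and `forget` removes it; after the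
exchange the former inner color is the outer one. -/
theorem colors_swapColors (D : DTree (fun n => (X n × Ω) × Ω') A) :
    (D.mapDec (swapColors X Ω Ω')).colors = (forget (X := fun n => X n × Ω) D).colors := by
  induction D with
  | leaf a => rfl
  | node x child ih => exact congrArg (fun b => x.1.2 :: (List.ofFn b).flatten) (funext ih)

theorem colors_forget_swapColors (D : DTree (fun n => (X n × Ω) × Ω') A) :
    (forget (X := fun n => X n × Ω') (D.mapDec (swapColors X Ω Ω'))).colors =
      colors (X := fun n => X n × Ω) D := by
  induction D with
  | leaf a => rfl
  | node x child ih => exact congrArg (fun b => x.2 :: (List.ofFn b).flatten) (funext ih)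

theorem forget_forget_swapColors (D : DTree (fun n => (X n × Ω) × Ω') A) :
    (forget (X := fun n => X n × Ω') (D.mapDec (swapColors X Ω Ω'))).forget =
      (forget (X := fun n => X n × Ω) D).forget := by
  induction D with
  | leaf a => rfl
  | node x child ih => exact congrArg (DTree.node x.1.1) (funext ih)

theorem forget_pairColors (D : DTree (fun n => (X n × Ω) × Ω') A) :
    (D.mapDec (pairColors X Ω Ω')).forget = (forget (X := fun n => X n × Ω) D).forget := by
  induction D with
  | leaf a => rfl
  | node x child ih => exact congrArg (DTree.node x.1.1) (funext ih)

theorem map_fst_colors_pairColors (D : DTree (fun n => (X n × Ω) × Ω') A) :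
    (D.mapDec (pairColors X Ω Ω')).colors.map Prod.fst =
      (forget (X := fun n => X n × Ω) D).colors := by
  induction D with
  | leaf a => rfl
  | node x child ih =>
    simp only [mapDec, colors, forget, List.map_cons, List.map_flatten, List.map_ofFn,
      Function.comp_def, ih]
    rfl

theorem map_snd_colors_pairColors (D : DTree (fun n => (X n × Ω) × Ω') A) :
    (D.mapDec (pairColors X Ω Ω')).colors.map Prod.snd = colors (X := fun n => X n × Ω) D := by
  induction D with
  | leaf a => rfl
  | node x child ih =>
    simp only [mapDec, colors, List.map_cons, List.map_flatten, List.map_ofFn,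
      Function.comp_def, ih]
    rfl

end DTree

namespace LTree

theorem colors_swapColors (D : LTree (fun n => (X n × Ω) × Ω') n) :
    (D.mapDec (swapColors X Ω Ω')).colors = (forget (X := fun n => X n × Ω) D).colors :=
  D.1.colors_swapColors

theorem colors_forget_swapColors (D : LTree (fun n => (X n × Ω) × Ω') n) :
    (forget (X := fun n => X n × Ω') (D.mapDec (swapColors X Ω Ω'))).colors =
      colors (X := fun n => X n × Ω) D :=
  D.1.colors_forget_swapColors

theorem forget_forget_swapColors (D : LTree (fun n => (X n × Ω) × Ω') n) :
    (forget (X := fun n => X n × Ω') (D.mapDec (swapColors X Ω Ω'))).forget =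
      (forget (X := fun n => X n × Ω) D).forget :=
  Subtype.ext D.1.forget_forget_swapColors

theorem forget_pairColors (D : LTree (fun n => (X n × Ω) × Ω') n) :
    (D.mapDec (pairColors X Ω Ω')).forget = (forget (X := fun n => X n × Ω) D).forget :=
  Subtype.ext D.1.forget_pairColors

theorem colors_pairColors_eq_iff (D : LTree (fun n => (X n × Ω) × Ω') n) (L : List (Ω × Ω')) :
    (D.mapDec (pairColors X Ω Ω')).colors = L ↔
      (forget (X := fun n => X n × Ω) D).colors = L.map Prod.fst ∧
        colors (X := fun n => X n × Ω) D = L.map Prod.snd := by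
  have h1 := D.1.map_fst_colors_pairColors
  have h2 := D.1.map_snd_colors_pairColors
  constructor
  · rintro rfl
    exact ⟨h1.symm, h2.symm⟩
  · rintro ⟨h3, h4⟩
    -- A list of pairs is recovered from its two projections by zipping them.
    have h : (D.1.mapDec (pairColors X Ω Ω')).colors.unzip = L.unzip := by
      rw [List.unzip_eq_map, List.unzip_eq_map, h1, h2]
      exact congrArg₂ Prod.mk h3 h4
    have := congrArg (fun p : List Ω × List Ω' => p.1.zip p.2) h
    rwa [List.zip_unzip, List.zip_unzip] at this

end LTree

variable {k : Type z} [Field k]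

/-- Both sides take the coefficient of `r` at the doubly forgotten tree, subject to the same two
conditions (colors in `Ω'` equal to `l`, type in `Ω` equal to `c`), nested in opposite orders. -/
theorem IsColoring.map_swapColors {r : Free k X n} {c : Ω →₀ ℕ} {l : List Ω'}
    {f : Free k (fun n => X n × Ω') n} {g : Free k (fun n => (X n × Ω) × Ω') n}
    (hf : IsColoring r l f) (hg : IsColoring (quasipolarization r c) l g) :
    Free.map (swapColors X Ω Ω') n g = quasipolarization f c := by
  classical
  refine Free.map_eq_of_apply (e' := swapColors X Ω' Ω) (fun _ _ => rfl) (fun _ _ => rfl)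
    fun D => ?_
  rw [quasipolarization_apply, hf, hg, quasipolarization_apply, D.colors_forget_swapColors,
    D.forget_forget_swapColors, LTree.type_eq_of_colors_eq D.colors_swapColors]
  split_ifs <;> rfl

/-- Coloring first by the list of first components and then by that of second components is one
coloring by `L`. -/
theorem IsColoring.map_pairColors {r : Free k X n} {L : List (Ω × Ω')}
    {f : Free k (fun n => X n × Ω) n} {g : Free k (fun n => (X n × Ω) × Ω') n}
    {h : Free k (fun n => X n × (Ω × Ω')) n} (hf : IsColoring r (L.map Prod.fst) f)
    (hg : IsColoring f (L.map Prod.snd) g) (hh : IsColoring r L h) :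
    Free.map (pairColors X Ω Ω') n g = h := by
  refine Free.map_eq_of_apply (e' := unpairColors X Ω Ω') (fun _ _ => rfl) (fun _ _ => rfl)
    fun D => ?_
  rw [hg, hf, hh, D.forget_pairColors, ← ite_and]
  exact @if_congr _ _ _ (_) (_) _ _ _ _
    ((D.colors_pairColors_eq_iff L).trans and_comm) rfl rfl

end Colors

/-! ### Matching the relations of the iterated constructions -/

namespace OperadPresentation

variable {k : Type w} [Field k] (P : OperadPresentation.{u} k) (Ω : Type v) (Ω' : Type z)

theorem map_swapColors_lmt_lin_rel [Nonempty Ω'] {n : ℕ} {g : Free k ((P.lin Ω).lmt Ω').gen n}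
    (hg : g ∈ ((P.lin Ω).lmt Ω').rel n) (h0 : g ≠ 0) :
    Free.map (swapColors P.gen Ω Ω') n g ∈ ((P.lmt Ω').lin Ω).rel n := by
  obtain ⟨m, _, l, ⟨m', r, c, hr, hm', hc, rfl⟩, hm, hl, hcol⟩ :=
    exists_isColoring_of_mem_lmt_rel hg
  -- The weight measured on the quasipolarization is that of `r`, so `l` also has the right length
  -- to color `r` itself.
  obtain rfl := hm.eq (isHomogeneous_quasipolarization hm' c) (hcol.ne_zero h0)
  obtain ⟨f, hf, hcol'⟩ := exists_mem_lmt_rel hr hm' hl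
  exact ⟨m, f, c, hf, hcol'.isHomogeneous hm', hc, hcol'.map_swapColors hcol⟩

theorem map_swapColors_lin_lmt_rel [Nonempty Ω'] {n : ℕ} {g : Free k ((P.lmt Ω').lin Ω).gen n}
    (hg : g ∈ ((P.lmt Ω').lin Ω).rel n) (h0 : g ≠ 0) :
    Free.map (swapColors P.gen Ω' Ω) n g ∈ ((P.lin Ω).lmt Ω').rel n := by
  obtain ⟨m, f, c, hf, hm, hc, rfl⟩ := hg
  obtain ⟨m', r, l, hr, hm', hl, hcol⟩ := exists_isColoring_of_mem_lmt_rel hf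
  have hf0 : f ≠ 0 := by
    rintro rfl
    exact h0 Finsupp.sum_zero_index
  obtain rfl := hm.eq (hcol.isHomogeneous hm') hf0
  obtain ⟨g, hg, hcol'⟩ := exists_mem_lmt_rel (P := P.lin Ω) (r := quasipolarization r c)
    ⟨m, r, c, hr, hm', hc, rfl⟩ (isHomogeneous_quasipolarization hm' c) hl
  -- The forward computation exhibits the given relation as the image of `g`; exchanging the colors
  -- back returns `g`.
  have h := Free.map_map_of_leftInverse (e := swapColors P.gen Ω Ω')
    (e' := swapColors P.gen Ω' Ω) (fun _ _ => rfl) g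
  rw [IsColoring.map_swapColors hcol hcol'] at h
  exact Set.mem_of_eq_of_mem h hg

theorem map_pairColors_lmt_lmt_rel [Nonempty Ω] [Nonempty Ω'] {n : ℕ}
    {g : Free k ((P.lmt Ω).lmt Ω').gen n} (hg : g ∈ ((P.lmt Ω).lmt Ω').rel n) (h0 : g ≠ 0) :
    Free.map (pairColors P.gen Ω Ω') n g ∈ (P.lmt (Ω × Ω')).rel n := by
  obtain ⟨m, f, l', hf, hm, hl', hcol⟩ := exists_isColoring_of_mem_lmt_rel hg
  obtain ⟨m', r, l, hr, hm', hl, hcol'⟩ := exists_isColoring_of_mem_lmt_rel hf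
  obtain rfl := hm.eq (hcol'.isHomogeneous hm') (hcol.ne_zero h0)
  -- Once the weights agree, `l` and `l'` have equal length, so zipping truncates neither and both
  -- are recovered as projections.
  obtain ⟨h, hh, hcol''⟩ := exists_mem_lmt_rel hr hm' (l := l.zip l')
    (by rw [List.length_zip, hl, hl', min_self])
  rw [← List.map_fst_zip (hl.trans hl'.symm).le] at hcol'
  rw [← List.map_snd_zip (hl'.trans hl.symm).le] at hcol
  exact Set.mem_of_eq_of_mem (hcol'.map_pairColors hcol hcol'') hh

/-- No nonvanishing is required in this direction: the two color lists are projections of a single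
list, so their lengths agree automatically. -/
theorem map_unpairColors_lmt_rel [Nonempty Ω] [Nonempty Ω'] {n : ℕ}
    {h : Free k (P.lmt (Ω × Ω')).gen n} (hh : h ∈ (P.lmt (Ω × Ω')).rel n) :
    Free.map (unpairColors P.gen Ω Ω') n h ∈ ((P.lmt Ω).lmt Ω').rel n := by
  obtain ⟨m, r, L, hr, hm, hL, hcol⟩ := exists_isColoring_of_mem_lmt_rel hh
  obtain ⟨f, hf, hcol'⟩ := exists_mem_lmt_rel hr hm (l := L.map Prod.fst) (by simpa using hL)
  obtain ⟨g, hg, hcol''⟩ := exists_mem_lmt_rel hf (hcol'.isHomogeneous hm)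
    (l := L.map Prod.snd) (by simpa using hL)
  have h' := Free.map_map_of_leftInverse (e := pairColors P.gen Ω Ω')
    (e' := unpairColors P.gen Ω Ω') (fun _ _ => rfl) g
  rw [IsColoring.map_pairColors hcol' hcol'' hcol] at h'
  exact Set.mem_of_eq_of_mem h' hg

end OperadPresentation

end OperadCompat

theorem mainTheorem10 {k : Type w} [Field k] [CharZero k] {Ω : Type v} [Nonempty Ω]
    (P : OperadCompat.OperadPresentation.{u} k) (hP : P.LocallyHomogeneous) :
    (∃ φ : OperadCompat.OperadPresentation.Iso ((P.lin Ω).lmt Ω) ((P.lmt Ω).lin Ω),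
      ∀ (n : ℕ) (x : P.gen n) (μ ν : Ω),
        φ.equiv n (((P.lin Ω).lmt Ω).of ((x, μ), ν)) = ((P.lmt Ω).lin Ω).of ((x, ν), μ)) ∧
    (∃ φ : OperadCompat.OperadPresentation.Iso ((P.lmt Ω).lmt Ω) (P.lmt (Ω × Ω)),
      ∀ (n : ℕ) (x : P.gen n) (μ ν : Ω),
        φ.equiv n (((P.lmt Ω).lmt Ω).of ((x, μ), ν)) = (P.lmt (Ω × Ω)).of (x, (μ, ν))) := by
  constructor
  · obtain ⟨φ, hφ⟩ := OperadCompat.OperadPresentation.exists_iso_of_rel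
      (P := (P.lin Ω).lmt Ω) (Q := (P.lmt Ω).lin Ω)
      (OperadCompat.swapColors P.gen Ω Ω) (OperadCompat.swapColors P.gen Ω Ω)
      (fun _ _ => rfl) (fun _ _ => rfl)
      (fun _ _ hr h0 => P.map_swapColors_lmt_lin_rel Ω Ω hr h0)
      (fun _ _ hr h0 => P.map_swapColors_lin_lmt_rel Ω Ω hr h0)
    exact ⟨φ, fun n x μ ν => hφ n ((x, μ), ν)⟩
  · obtain ⟨φ, hφ⟩ := OperadCompat.OperadPresentation.exists_iso_of_rel
      (P := (P.lmt Ω).lmt Ω) (Q := P.lmt (Ω × Ω))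
      (OperadCompat.pairColors P.gen Ω Ω) (OperadCompat.unpairColors P.gen Ω Ω)
      (fun _ _ => rfl) (fun _ _ => rfl)
      (fun _ _ hr h0 => P.map_pairColors_lmt_lmt_rel Ω Ω hr h0)
      (fun _ _ hr _ => P.map_unpairColors_lmt_rel Ω Ω hr)
    exact ⟨φ, fun n x μ ν => hφ n ((x, μ), ν)⟩
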